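/- Let $k$ be a perfect field of characteristic $p>0$. A $k$-variety is an integral separated scheme of finite type over $k$. Let $X$ and $Z$ be normal $k$-varieties and let $g\colon X\to Z$ be a finite surjective morphism of schemes, not necessarily over $k$, that is purely inseparable of height one: the extension $k(Z)\subseteq k(X)$ of function fields is purely inseparable, and there is a morphism of schemes $h\colon Z\to X$ such that $h\circ g=F_X$, where $F_X$ is the absolute Frobenius of $X$ (the identity on points and $s\mapsto s^p$ on functions). For a Cartier divisor $L$ on a $k$-variety $Y$, let $\mathrm{Bs}(L)$ be the base locus of the complete linear system $|L|$, that is, the intersection of the supports of all effective Cartier divisors linearly equivalent to $L$ (all of $Y$ if there are none). Put $\mathbf B(L)=\bigl(\bigcap_{m\ge 1}\mathrm{Bs}(mL)\bigr)_{\mathrm{red}}$. For a $\mathbb Q$-divisor $D\in \mathrm{Div}(Y)\otimes_{\mathbb Z}\mathbb Q$, where $\mathrm{Div}(Y)$ is the group of Cartier divisors, put $\mathbf B(D)=\mathbf B(bD)$ for any integer $b\ge 1$ such that $bD$ is Cartier; this does not depend on $b$. Then for every $\mathbb Q$-divisor $D$ on $Z$, $$\mathbf B(g^*D)=g^{-1}\mathbf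 B(D)$$ as reduced closed subschemes of $X$, where $g^{-1}\mathbf B(D)$ is the reduced scheme associated to the scheme-theoretic preimage of $\mathbf B(D)$ under $g$. -/

import Mathlib

open CategoryTheory AlgebraicGeometry TopologicalSpace
open scoped TensorProduct

universe u

noncomputable section

namespace StableBase

/-! ### Function fields and dominant morphisms -/

/-- A scheme is normal if all its local rings are integrally closed domains; it is used
here for integral schemes, where the local rings are domains. -/
def IsNormalScheme (X : Scheme.{u}) : Prop :=
  ∀ x : X, IsIntegrallyClosed (X.presheaf.stalk x)

lemma map_genericPoint_specializes {X Z : Scheme.{u}} [IsIntegral X] [IsIntegral Z]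
    (g : X ⟶ Z) [IsDominant g] : g (genericPoint X) ⤳ genericPoint Z := by
  have h := (genericPoint_spec X).image g.continuous
  have h2 : closure (g '' (Set.univ : Set X)) = Set.univ := by
    rw [Set.image_univ]; exact g.denseRange.closure_range
  rw [h2] at h
  exact h.specializes trivial

/-- The homomorphism of function fields `k(Z) → k(X)` induced by a dominant morphism
`g : X ⟶ Z` of integral schemes. -/
def functionFieldMap {X Z : Scheme.{u}} [IsIntegral X] [IsIntegral Z]
    (g : X ⟶ Z) [IsDominant g] : Z.functionField →+* X.functionField :=
  (Z.presheaf.stalkSpecializes (map_genericPoint_specializes g) ≫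
    g.stalkMap (genericPoint X)).hom

lemma functionFieldMap_algebraMap {X Z : Scheme.{u}} [IsIntegral X] [IsIntegral Z]
    (g : X ⟶ Z) [IsDominant g] (x : X) (a : Z.presheaf.stalk (g x)) :
    functionFieldMap g (algebraMap (Z.presheaf.stalk (g x)) Z.functionField a) =
      algebraMap (X.presheaf.stalk x) X.functionField (g.stalkMap x a) := by
  have h := g.stalkSpecializes_stalkMap_apply (genericPoint X) x (genericPoint_specializes x) a
  have h2 : ∀ b, (Z.presheaf.stalkSpecializes (map_genericPoint_specializes g))
      ((Z.presheaf.stalkSpecializes (genericPoint_specializes (g x))) b) =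
      Z.presheaf.stalkSpecializes (g.base.hom.map_specializes (genericPoint_specializes x)) b := by
    intro b
    rw [← CommRingCat.comp_apply, TopCat.Presheaf.stalkSpecializes_comp]
  refine Eq.trans ?_ h
  exact congrArg (g.stalkMap (genericPoint X)) (h2 a)

/-! ### Cartier divisors on integral schemes -/

/-- The units of `𝒪_{X, x}` as a subgroup of the units of the function field. -/
def stalkUnits (X : Scheme.{u}) [IsIntegral X] (x : X) : Subgroup (X.functionField)ˣ :=
  (Units.map (algebraMap (X.presheaf.stalk x) X.functionField).toMonoidHom).range

/-- `k(X)ˣ / 𝒪_{X, x}ˣ`, written additively: the stalk at `x` of the sheaf `𝒦ˣ / 𝒪ˣ`. -/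
def CartierStalk (X : Scheme.{u}) [IsIntegral X] (x : X) : Type u :=
  Additive ((X.functionField)ˣ ⧸ stalkUnits X x)

instance (X : Scheme.{u}) [IsIntegral X] (x : X) : AddCommGroup (CartierStalk X x) :=
  inferInstanceAs (AddCommGroup (Additive ((X.functionField)ˣ ⧸ stalkUnits X x)))

/-- The class of a nonzero rational function in the stalk at `x` of `𝒦ˣ / 𝒪ˣ`. -/
def localClass {X : Scheme.{u}} [IsIntegral X] (x : X) (f : (X.functionField)ˣ) :
    CartierStalk X x :=
  Additive.ofMul (QuotientGroup.mk f)

lemma localClass_mul {X : Scheme.{u}} [IsIntegral X] (x : X) (f f' : (X.functionField)ˣ) :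
    localClass x (f * f') = localClass x f + localClass x f' := rfl

lemma localClass_inv {X : Scheme.{u}} [IsIntegral X] (x : X) (f : (X.functionField)ˣ) :
    localClass x f⁻¹ = - localClass x f := rfl

lemma localClass_one {X : Scheme.{u}} [IsIntegral X] (x : X) :
    localClass x (1 : (X.functionField)ˣ) = 0 := rfl

/-- The group `Div(X)` of Cartier divisors on an integral scheme: the global sections of
the quotient sheaf `𝒦ˣ / 𝒪ˣ`, where `𝒦` is the constant sheaf `k(X)`. Such a section is a
family of germs that is locally given by one rational function (a local equation). -/
def CartierDivisor (X : Scheme.{u}) [IsIntegral X] : AddSubgroup (∀ x : X, CartierStalk X x) where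
  carrier := {D | ∀ x : X, ∃ U : X.Opens, x ∈ U ∧
    ∃ f : (X.functionField)ˣ, ∀ y ∈ U, D y = localClass y f}
  zero_mem' := fun x => ⟨⊤, trivial, 1, fun y _ => (localClass_one y).symm⟩
  add_mem' := by
    intro D E hD hE x
    obtain ⟨U, hU, f, hf⟩ := hD x
    obtain ⟨V, hV, e, he⟩ := hE x
    refine ⟨U ⊓ V, ⟨hU, hV⟩, f * e, fun y hy => ?_⟩
    rw [localClass_mul, ← hf y hy.1, ← he y hy.2]; rfl
  neg_mem' := by
    intro D hD x
    obtain ⟨U, hU, f, hf⟩ := hD x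
    refine ⟨U, hU, f⁻¹, fun y hy => ?_⟩
    rw [localClass_inv, ← hf y hy]; rfl

/-- The principal Cartier divisor of a nonzero rational function. -/
def principal {X : Scheme.{u}} [IsIntegral X] (f : (X.functionField)ˣ) : CartierDivisor X :=
  ⟨fun x => localClass x f, fun _ => ⟨⊤, trivial, f, fun _ _ => rfl⟩⟩

/-- Linear equivalence of Cartier divisors. -/
def LinEquiv {X : Scheme.{u}} [IsIntegral X] (D E : CartierDivisor X) : Prop :=
  ∃ f : (X.functionField)ˣ, D - E = principal f

/-- A Cartier divisor is effective if its local equations are regular functions. -/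
def IsEffective {X : Scheme.{u}} [IsIntegral X] (D : CartierDivisor X) : Prop :=
  ∀ (x : X) (f : (X.functionField)ˣ), D.1 x = localClass x f →
    (f : X.functionField) ∈ (algebraMap (X.presheaf.stalk x) X.functionField).range

lemma mem_stalkUnits_nhds {X : Scheme.{u}} [IsIntegral X] (x : X) (f : (X.functionField)ˣ)
    (hf : f ∈ stalkUnits X x) : ∃ U : X.Opens, x ∈ U ∧ ∀ y ∈ U, f ∈ stalkUnits X y := by
  obtain ⟨a, rfl⟩ := hf
  obtain ⟨V, hxV, s, hs⟩ := X.presheaf.exists_germ_eq (a : X.presheaf.stalk x)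
  have hx : x ∈ X.basicOpen s := by
    rw [Scheme.mem_basicOpen X s x hxV, hs]; exact a.isUnit
  refine ⟨X.basicOpen s, hx, fun y hy => ?_⟩
  have hyV : y ∈ V := X.basicOpen_le s hy
  have hu : IsUnit (X.presheaf.germ V y hyV s) := (Scheme.mem_basicOpen X s y hyV).mp hy
  refine ⟨hu.unit, Units.ext ?_⟩
  have : Nonempty V := ⟨⟨x, hxV⟩⟩
  change algebraMap (X.presheaf.stalk y) X.functionField (X.presheaf.germ V y hyV s) =
    algebraMap (X.presheaf.stalk x) X.functionField (a : X.presheaf.stalk x)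
  rw [← hs, Scheme.algebraMap_germ_eq_germToFunctionField,
    Scheme.algebraMap_germ_eq_germToFunctionField]

/-- The support of a Cartier divisor: the closed set of points at which a local equation
is not a unit of the local ring. -/
def support {X : Scheme.{u}} [IsIntegral X] (D : CartierDivisor X) : Closeds X where
  carrier := {x | D.1 x ≠ 0}
  isClosed' := by
    rw [← isOpen_compl_iff, isOpen_iff_mem_nhds]
    intro x hx
    have hx : D.1 x = 0 := not_not.mp hx
    obtain ⟨U, hxU, f, hf⟩ := D.2 x
    have key : ∀ y, localClass y f = 0 ↔ f ∈ stalkUnits X y := fun y =>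
      QuotientGroup.eq_one_iff f
    obtain ⟨V, hxV, hV⟩ := mem_stalkUnits_nhds x f ((key x).mp (by rw [← hf x hxU, hx]))
    refine Filter.mem_of_superset ((U ⊓ V).isOpen.mem_nhds ⟨hxU, hxV⟩) fun y hy => ?_
    exact not_not.mpr ((hf y hy.1).trans ((key y).mpr (hV y hy.2)))

/-! ### Base loci -/

/-- The complete linear system `|L|`: the effective Cartier divisors linearly equivalent
to `L`. -/
def linearSystem {X : Scheme.{u}} [IsIntegral X] (L : CartierDivisor X) :
    Set (CartierDivisor X) :=
  {E | IsEffective E ∧ LinEquiv E L}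

/-- The base locus of `|L|`, the common support of its members (all of `X` if `|L|` is
empty). -/
def baseLocus {X : Scheme.{u}} [IsIntegral X] (L : CartierDivisor X) : Closeds X :=
  ⨅ E ∈ linearSystem L, support E

/-- The closed set underlying the stable base locus of a Cartier divisor. -/
def cartierStableLocus {X : Scheme.{u}} [IsIntegral X] (L : CartierDivisor X) : Closeds X :=
  ⨅ m : ℕ+, baseLocus ((m : ℕ) • L)

/-- The group of `ℚ`-divisors `Div(X) ⊗ ℚ`. -/
abbrev QDivisor (X : Scheme.{u}) [IsIntegral X] : Type u := ℚ ⊗[ℤ] CartierDivisor X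

/-- The `ℚ`-divisor of a Cartier divisor. -/
def toQDivisor {X : Scheme.{u}} [IsIntegral X] (L : CartierDivisor X) : QDivisor X :=
  (1 : ℚ) ⊗ₜ[ℤ] L

/-- The closed set underlying the stable base locus of a `ℚ`-divisor `D`, namely that of
the Cartier divisor `bD`, for any positive integer `b` such that `bD` is Cartier. The
intersection runs over all choices of `b` and of a Cartier divisor representing `bD`; the
choices exist and all give the same set, see `stableLocus_eq`. -/
def stableLocus {X : Scheme.{u}} [IsIntegral X] (D : QDivisor X) : Closeds X :=
  ⨅ (b : ℕ+) (L : CartierDivisor X) (_ : (b : ℕ) • D = toQDivisor L), cartierStableLocus L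

/-- The stable base locus `𝐁(D)` of a `ℚ`-divisor as a reduced closed subscheme, given by
its ideal sheaf. -/
def stableBaseLocus {X : Scheme.{u}} [IsIntegral X] (D : QDivisor X) : X.IdealSheafData :=
  Scheme.IdealSheafData.vanishingIdeal (stableLocus D)

/-- The reduced closed subscheme associated to the scheme-theoretic preimage of a closed
subscheme, given by ideal sheaves. -/
def reducedPreimage {X Z : Scheme.{u}} (g : X ⟶ Z) (I : Z.IdealSheafData) :
    X.IdealSheafData :=
  (I.comap g).radical

/-! ### Independence of the choices -/

lemma isEffective_nsmul {X : Scheme.{u}} [IsIntegral X] {E : CartierDivisor X}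
    (hE : IsEffective E) (n : ℕ) : IsEffective (n • E) := by
  intro x f hf
  obtain ⟨U, hxU, e, he⟩ := E.2 x
  obtain ⟨a, ha⟩ := hE x e (he x hxU)
  have h1 : localClass x f = localClass x (e ^ n) := by
    rw [← hf]
    change n • E.1 x = _
    rw [he x hxU]; rfl
  have h2 : (e ^ n)⁻¹ * f ∈ stalkUnits X x := QuotientGroup.eq.mp h1.symm
  obtain ⟨v, hv⟩ := h2
  refine ⟨a ^ n * v, ?_⟩
  have h3 : f = e ^ n * Units.map (algebraMap (X.presheaf.stalk x) X.functionField).toMonoidHom v := by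
    rw [hv]; simp
  rw [h3, map_mul, map_pow, ha]
  simp

lemma linEquiv_nsmul {X : Scheme.{u}} [IsIntegral X] {D E : CartierDivisor X}
    (h : LinEquiv D E) (n : ℕ) : LinEquiv (n • D) (n • E) := by
  obtain ⟨f, hf⟩ := h
  refine ⟨f ^ n, ?_⟩
  rw [← nsmul_sub, hf]
  rfl

lemma baseLocus_nsmul_le {X : Scheme.{u}} [IsIntegral X] (L : CartierDivisor X) (n : ℕ) :
    baseLocus (n • L) ≤ baseLocus L := by
  refine le_iInf₂ fun E hE => ?_
  refine (iInf₂_le (n • E) ⟨isEffective_nsmul hE.1 n, linEquiv_nsmul hE.2 n⟩).trans ?_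
  intro x hx h0
  refine hx ?_
  change n • E.1 x = 0
  rw [h0, nsmul_zero]

lemma cartierStableLocus_nsmul {X : Scheme.{u}} [IsIntegral X] (L : CartierDivisor X) (n : ℕ+) :
    cartierStableLocus ((n : ℕ) • L) = cartierStableLocus L := by
  apply le_antisymm
  · refine le_iInf fun m => (iInf_le _ m).trans ?_
    rw [smul_comm]
    exact baseLocus_nsmul_le _ _
  · refine le_iInf fun m => (iInf_le _ (m * n)).trans ?_
    rw [smul_smul, PNat.mul_coe]

lemma exists_cartier_multiple {X : Scheme.{u}} [IsIntegral X] (D : QDivisor X) :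
    ∃ (b : ℕ+) (L : CartierDivisor X), (b : ℕ) • D = toQDivisor L := by
  induction D using TensorProduct.induction_on with
  | zero => exact ⟨1, 0, by simp [toQDivisor]⟩
  | tmul q L =>
    refine ⟨⟨q.den, q.den_pos⟩, q.num • L, ?_⟩
    change q.den • (q ⊗ₜ[ℤ] L) = (1 : ℚ) ⊗ₜ[ℤ] (q.num • L)
    rw [TensorProduct.tmul_smul, TensorProduct.smul_tmul', TensorProduct.smul_tmul']
    congr 1
    simp [Rat.den_mul_eq_num]
  | add D E hD hE =>
    obtain ⟨b, L, h⟩ := hD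
    obtain ⟨c, M, h'⟩ := hE
    refine ⟨b * c, (c : ℕ) • L + (b : ℕ) • M, ?_⟩
    have e : ∀ (n : ℕ) (A : CartierDivisor X), toQDivisor (n • A) = n • toQDivisor A :=
      fun n A => map_nsmul (TensorProduct.mk ℤ ℚ (CartierDivisor X) 1) n A
    have e' : ∀ A B : CartierDivisor X, toQDivisor (A + B) = toQDivisor A + toQDivisor B :=
      fun A B => TensorProduct.tmul_add _ _ _
    rw [e', e, e, ← h, ← h', smul_add, PNat.mul_coe, smul_smul, smul_smul, mul_comm (c : ℕ)]

lemma toQDivisor_eq_zero {X : Scheme.{u}} [IsIntegral X] {L : CartierDivisor X}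
    (h : toQDivisor L = 0) : ∃ n : ℕ+, (n : ℕ) • L = 0 := by
  have : IsLocalizedModule (nonZeroDivisors ℤ) (TensorProduct.mk ℤ ℚ (CartierDivisor X) 1) :=
    (isLocalizedModule_iff_isBaseChange (nonZeroDivisors ℤ) ℚ _).mpr
      (TensorProduct.isBaseChange ℤ (CartierDivisor X) ℚ)
  obtain ⟨c, hc⟩ := (IsLocalizedModule.eq_zero_iff (nonZeroDivisors ℤ)
    (TensorProduct.mk ℤ ℚ (CartierDivisor X) 1)).mp h
  have hc0 : (c : ℤ) ≠ 0 := nonZeroDivisors.ne_zero c.2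
  refine ⟨⟨(c : ℤ).natAbs, Int.natAbs_pos.mpr hc0⟩, ?_⟩
  have hc' : (c : ℤ) • L = 0 := hc
  change (c : ℤ).natAbs • L = 0
  rw [← natCast_zsmul]
  rcases Int.natAbs_eq (c : ℤ) with h1 | h1
  · rw [← h1, hc']
  · rw [h1, neg_smul, neg_eq_zero] at hc'; exact hc'

lemma cartierStableLocus_congr {X : Scheme.{u}} [IsIntegral X] {D : QDivisor X} {b c : ℕ+}
    {L M : CartierDivisor X} (hL : (b : ℕ) • D = toQDivisor L)
    (hM : (c : ℕ) • D = toQDivisor M) : cartierStableLocus L = cartierStableLocus M := by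
  have h : toQDivisor ((c : ℕ) • L - (b : ℕ) • M) = 0 := by
    have e : toQDivisor ((c : ℕ) • L - (b : ℕ) • M) =
        (c : ℕ) • toQDivisor L - (b : ℕ) • toQDivisor M := by
      change TensorProduct.mk ℤ ℚ (CartierDivisor X) 1 _ = _
      rw [map_sub, map_nsmul, map_nsmul]; rfl
    rw [e, ← hL, ← hM, smul_comm, sub_self]
  obtain ⟨n, hn⟩ := toQDivisor_eq_zero h
  rw [smul_sub, sub_eq_zero, smul_smul, smul_smul, ← PNat.mul_coe, ← PNat.mul_coe] at hn
  rw [← cartierStableLocus_nsmul L (n * c), hn, cartierStableLocus_nsmul]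

lemma stableLocus_eq {X : Scheme.{u}} [IsIntegral X] {D : QDivisor X} {b : ℕ+}
    {L : CartierDivisor X} (hL : (b : ℕ) • D = toQDivisor L) :
    stableLocus D = cartierStableLocus L := by
  apply le_antisymm
  · exact (iInf_le _ b).trans ((iInf_le _ L).trans (iInf_le _ hL))
  · exact le_iInf fun c => le_iInf fun M => le_iInf fun hM => (cartierStableLocus_congr hL hM).le

/-! ### Pullback of divisors -/

/-- The map `k(Z)ˣ / 𝒪_{Z, g(x)}ˣ → k(X)ˣ / 𝒪_{X, x}ˣ` induced by a dominant morphism. -/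
def cartierStalkMap {X Z : Scheme.{u}} [IsIntegral X] [IsIntegral Z] (g : X ⟶ Z)
    [IsDominant g] (x : X) : CartierStalk Z (g x) →+ CartierStalk X x :=
  MonoidHom.toAdditive (QuotientGroup.map (stalkUnits Z (g x)) (stalkUnits X x)
    (Units.map (functionFieldMap g).toMonoidHom) (by
      rintro _ ⟨a, rfl⟩
      exact ⟨Units.map (g.stalkMap x).hom.toMonoidHom a,
        Units.ext (functionFieldMap_algebraMap g x a).symm⟩))

/-- Pullback of Cartier divisors along a dominant morphism of integral schemes: local
equations are pulled back. -/
def pullbackDivisor {X Z : Scheme.{u}} [IsIntegral X] [IsIntegral Z] (g : X ⟶ Z)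
    [IsDominant g] : CartierDivisor Z →+ CartierDivisor X where
  toFun D := ⟨fun x => cartierStalkMap g x (D.1 (g x)), by
    intro x
    obtain ⟨U, hU, f, hf⟩ := D.2 (g x)
    refine ⟨g ⁻¹ᵁ U, hU, Units.map (functionFieldMap g).toMonoidHom f, fun y hy => ?_⟩
    exact (congrArg (cartierStalkMap g y) (hf (g y) hy)).trans rfl⟩
  map_zero' := Subtype.ext (funext fun x => map_zero (cartierStalkMap g x))
  map_add' D E := Subtype.ext (funext fun x => map_add (cartierStalkMap g x) _ _)

/-- Pullback of `ℚ`-divisors, the `ℚ`-linear extension of the pullback of Cartier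
divisors. -/
def pullbackQDivisor {X Z : Scheme.{u}} [IsIntegral X] [IsIntegral Z] (g : X ⟶ Z)
    [IsDominant g] : QDivisor Z →ₗ[ℤ] QDivisor X :=
  (pullbackDivisor g).toIntLinearMap.lTensor ℚ

/-! ### Absolute Frobenius and purely inseparable morphisms -/

/-- The Frobenius of a commutative ring in which the prime `p` is zero (the zero ring is
allowed). -/
def ringFrobenius (p : ℕ) [Fact p.Prime] (R : Type u) [CommRing R] (h : (p : R) = 0) :
    R →+* R where
  toFun a := a ^ p
  map_one' := one_pow p
  map_mul' a b := mul_pow a b p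
  map_zero' := zero_pow (Fact.out : p.Prime).ne_zero
  map_add' a b := by
    obtain ⟨r, hr⟩ := exists_add_pow_prime_eq (Fact.out : p.Prime) a b
    rw [hr, h]; ring

lemma natCast_section_eq_zero {X : Scheme.{u}} {p : ℕ} (h : (p : Γ(X, ⊤)) = 0) (U : X.Opens) :
    (p : Γ(X, U)) = 0 := by
  have := congrArg (X.presheaf.map (homOfLE (le_top : U ≤ ⊤)).op).hom h
  rwa [map_natCast, map_zero] at this

lemma natCast_eq_zero_of_field {k : Type u} [Field k] (p : ℕ) [CharP k p] {X : Scheme.{u}}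
    (s : X ⟶ Spec (.of k)) : (p : Γ(X, ⊤)) = 0 := by
  have h : (p : k) = 0 := CharP.cast_eq_zero k p
  have := congrArg ((Scheme.ΓSpecIso (.of k)).inv ≫ s.appTop).hom h
  rwa [map_natCast, map_zero] at this

/-- The action of Frobenius on the structure sheaf, `s ↦ s ^ p` on every open set. -/
def frobeniusSheafMap (p : ℕ) [Fact p.Prime] (X : Scheme.{u}) (h : (p : Γ(X, ⊤)) = 0) :
    X.presheaf ⟶ X.presheaf where
  app U := CommRingCat.ofHom
    (ringFrobenius p (X.presheaf.obj U) (natCast_section_eq_zero h U.unop))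
  naturality U V i := by
    ext a
    exact (map_pow (X.presheaf.map i).hom a p).symm

/-- Frobenius as a morphism of ringed spaces: the identity on the underlying space and
`s ↦ s ^ p` on functions. -/
def frobeniusPresheafedHom (p : ℕ) [Fact p.Prime] (X : Scheme.{u}) (h : (p : Γ(X, ⊤)) = 0) :
    X.toPresheafedSpace.Hom X.toPresheafedSpace where
  base := 𝟙 X.toPresheafedSpace.carrier
  c := frobeniusSheafMap p X h

lemma frobenius_stalkMap (p : ℕ) [Fact p.Prime] (X : Scheme.{u}) (h : (p : Γ(X, ⊤)) = 0)
    (x : X) (a : X.presheaf.stalk x) :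
    (PresheafedSpace.Hom.stalkMap (frobeniusPresheafedHom p X h) x).hom a = a ^ p := by
  obtain ⟨U, hxU, s, rfl⟩ := X.presheaf.exists_germ_eq a
  have := PresheafedSpace.stalkMap_germ_apply (frobeniusPresheafedHom p X h) U x hxU s
  refine Eq.trans this ?_
  exact map_pow (X.presheaf.germ U x hxU).hom s p

/-- The absolute Frobenius morphism of a scheme in characteristic `p`. -/
def absoluteFrobenius (p : ℕ) [Fact p.Prime] (X : Scheme.{u}) (h : (p : Γ(X, ⊤)) = 0) :
    X ⟶ X :=
  Scheme.Hom.mk (LocallyRingedSpace.Hom.mk (frobeniusPresheafedHom p X h) fun x => ⟨fun a ha => by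
    have e : (PresheafedSpace.Hom.stalkMap (frobeniusPresheafedHom p X h) x).hom a = a ^ p :=
      frobenius_stalkMap p X h x a
    rw [e] at ha
    exact (isUnit_pow_iff (Fact.out : p.Prime).ne_zero).mp ha⟩)

/-- A finite surjective morphism `g : X ⟶ Z` of integral schemes, not required to be a
morphism over a base, is purely inseparable if `k(X)` is a purely inseparable extension of
`k(Z)`. -/
structure IsPurelyInseparableMorphism {X Z : Scheme.{u}} [IsIntegral X] [IsIntegral Z]
    (g : X ⟶ Z) [IsDominant g] : Prop where
  finite : IsFinite g
  surjective : Surjective g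
  functionField :
    letI := (functionFieldMap g).toAlgebra
    IsPurelyInseparable Z.functionField X.functionField

/-- A purely inseparable morphism `g : X ⟶ Z` has height one if the absolute Frobenius of
`X` factors through `g`. -/
structure IsPurelyInseparableOfHeightOne (p : ℕ) [Fact p.Prime] {X Z : Scheme.{u}}
    [IsIntegral X] [IsIntegral Z] (hp : (p : Γ(X, ⊤)) = 0) (g : X ⟶ Z) [IsDominant g] :
    Prop extends IsPurelyInseparableMorphism g where
  exists_factor : ∃ h : Z ⟶ X, g ≫ h = absoluteFrobenius p X hp

end StableBase

end

namespace StableBase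

/-! Pulling back along a dominant morphism sends members of `|L|` to members of `|g^*L|` and can
only shrink supports, so `B(g^*L) ⊆ g⁻¹ B(L)` for Cartier `L`. For the reverse inclusion, apply the
same fact to `h` and the divisor `g^*L`. Since `h ∘ g` is Frobenius, `g ∘ h` is the identity on
points and the `p`-th power on `k(Z)`, whence `h^*g^*L = pL`
(`pullbackDivisor_pullbackDivisor_eq_nsmul`). So `B(L) = B(pL) = B(h^*g^*L) ⊆ h⁻¹ B(g^*L)`, and `h
(g x) = x` turns `g x ∈ B(L)` into `x ∈ B(g^*L)`. Clearing denominators gives the case of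
ℚ-divisors, and a reduced closed subscheme is determined by its support. -/

/-- Frobenius enters as a variable `f` with an equation, so that the result applies to `g ≫ h`
without transporting elements between stalks at `h (g x)` and `x`. -/
lemma algebraMap_stalkMap_of_eq_absoluteFrobenius {p : ℕ} [Fact p.Prime] {X : Scheme.{u}}
    [IsIntegral X] {hp : (p : Γ(X, ⊤)) = 0} {f : X ⟶ X} (hf : f = absoluteFrobenius p X hp)
    (x : X) (a : X.presheaf.stalk (f x)) :
    algebraMap (X.presheaf.stalk x) X.functionField (f.stalkMap x a) =
      (algebraMap (X.presheaf.stalk (f x)) X.functionField a) ^ p := by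
  subst hf
  have e : (absoluteFrobenius p X hp).stalkMap x a = (show X.presheaf.stalk x from a) ^ p :=
    frobenius_stalkMap p X hp x a
  rw [e, map_pow]
  rfl

/-- On the image of a local ring both maps are induced by stalk maps, whose composite is that of
Frobenius; fractions then give all of `k(X)`. -/
lemma functionFieldMap_functionFieldMap_eq_pow {p : ℕ} [Fact p.Prime] {X Z : Scheme.{u}}
    [IsIntegral X] [IsIntegral Z] {hp : (p : Γ(X, ⊤)) = 0} {g : X ⟶ Z} {h : Z ⟶ X}
    [IsDominant g] [IsDominant h] (hgh : g ≫ h = absoluteFrobenius p X hp)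
    (a : X.functionField) :
    functionFieldMap g (functionFieldMap h a) = a ^ p := by
  let x := genericPoint X
  have key : ∀ b : X.presheaf.stalk (h (g x)),
      functionFieldMap g (functionFieldMap h (algebraMap _ X.functionField b)) =
        (algebraMap _ X.functionField b) ^ p := by
    intro b
    rw [functionFieldMap_algebraMap h (g x), functionFieldMap_algebraMap g x]
    refine Eq.trans ?_ (algebraMap_stalkMap_of_eq_absoluteFrobenius hgh x b)
    rw [Scheme.Hom.stalkMap_comp]
    rfl
  obtain ⟨b, c, _, rfl⟩ := IsFractionRing.div_surjective (A := X.presheaf.stalk (h (g x))) a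
  rw [map_div₀, map_div₀, key, key, div_pow]

/-- The other order of composition follows by cancelling the injective map `k(Z) → k(X)`. -/
lemma functionFieldMap_functionFieldMap_eq_pow' {p : ℕ} [Fact p.Prime] {X Z : Scheme.{u}}
    [IsIntegral X] [IsIntegral Z] {hp : (p : Γ(X, ⊤)) = 0} {g : X ⟶ Z} {h : Z ⟶ X}
    [IsDominant g] [IsDominant h] (hgh : g ≫ h = absoluteFrobenius p X hp)
    (a : Z.functionField) :
    functionFieldMap h (functionFieldMap g a) = a ^ p := by
  apply (functionFieldMap g).injective
  rw [functionFieldMap_functionFieldMap_eq_pow hgh, map_pow]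

lemma base_comp_of_comp_eq_absoluteFrobenius {p : ℕ} [Fact p.Prime] {X Z : Scheme.{u}}
    {hp : (p : Γ(X, ⊤)) = 0} {g : X ⟶ Z} {h : Z ⟶ X}
    (hgh : g ≫ h = absoluteFrobenius p X hp) (x : X) : h (g x) = x := by
  rw [← Scheme.Hom.comp_apply, hgh]
  rfl

/-! ### Pullback along dominant morphisms -/

variable {X Z : Scheme.{u}} [IsIntegral X] [IsIntegral Z]

lemma cartierStalkMap_localClass (g : X ⟶ Z) [IsDominant g] (x : X) (f : (Z.functionField)ˣ) :
    cartierStalkMap g x (localClass (g x) f) =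
      localClass x (Units.map (functionFieldMap g).toMonoidHom f) := rfl

lemma pullbackDivisor_principal (g : X ⟶ Z) [IsDominant g] (f : (Z.functionField)ˣ) :
    pullbackDivisor g (principal f) =
      principal (Units.map (functionFieldMap g).toMonoidHom f) := rfl

lemma LinEquiv.pullbackDivisor (g : X ⟶ Z) [IsDominant g] {D E : CartierDivisor Z}
    (h : LinEquiv D E) : LinEquiv (pullbackDivisor g D) (pullbackDivisor g E) := by
  obtain ⟨f, hf⟩ := h
  exact ⟨_, by rw [← map_sub, hf, pullbackDivisor_principal]⟩

/-- Local equations of the same class differ by a unit of the local ring, so effectivity may be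
tested on any one of them. -/
lemma mem_range_algebraMap_of_localClass_eq {x : X} {e f : (X.functionField)ˣ}
    (h : localClass x e = localClass x f)
    (he : (e : X.functionField) ∈ (algebraMap (X.presheaf.stalk x) X.functionField).range) :
    (f : X.functionField) ∈ (algebraMap (X.presheaf.stalk x) X.functionField).range := by
  obtain ⟨v, hv⟩ : e⁻¹ * f ∈ stalkUnits X x := QuotientGroup.eq.mp h
  have hf : f = e * Units.map (algebraMap (X.presheaf.stalk x) X.functionField).toMonoidHom v := by
    rw [hv, mul_inv_cancel_left]
  rw [hf, Units.val_mul]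
  exact mul_mem he ⟨v, rfl⟩

lemma IsEffective.pullbackDivisor (g : X ⟶ Z) [IsDominant g] {E : CartierDivisor Z}
    (hE : IsEffective E) : IsEffective (pullbackDivisor g E) := by
  intro x f hf
  obtain ⟨U, hxU, e, he⟩ := E.2 (g x)
  obtain ⟨a, ha⟩ := hE (g x) e (he (g x) hxU)
  refine mem_range_algebraMap_of_localClass_eq
    (e := Units.map (functionFieldMap g).toMonoidHom e) ?_ ⟨g.stalkMap x a, ?_⟩
  · rw [← hf, ← cartierStalkMap_localClass, ← he (g x) hxU]
    rfl
  · refine (functionFieldMap_algebraMap g x a).symm.trans ?_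
    exact congrArg (functionFieldMap g) ha

lemma pullbackDivisor_mem_linearSystem (g : X ⟶ Z) [IsDominant g] {E L : CartierDivisor Z}
    (hE : E ∈ linearSystem L) : pullbackDivisor g E ∈ linearSystem (pullbackDivisor g L) :=
  ⟨hE.1.pullbackDivisor g, hE.2.pullbackDivisor g⟩

lemma mem_support {D : CartierDivisor X} {x : X} : x ∈ support D ↔ D.1 x ≠ 0 := Iff.rfl

lemma map_mem_support_of_mem_support_pullbackDivisor (g : X ⟶ Z) [IsDominant g]
    {E : CartierDivisor Z} {x : X} (hx : x ∈ support (pullbackDivisor g E)) :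
    g x ∈ support E := by
  rw [mem_support] at hx ⊢
  refine fun h0 => hx ?_
  change cartierStalkMap g x (E.1 (g x)) = 0
  rw [h0, map_zero]

lemma mem_baseLocus {L : CartierDivisor X} {x : X} :
    x ∈ baseLocus L ↔ ∀ E ∈ linearSystem L, x ∈ support E := by
  simp only [baseLocus, ← SetLike.mem_coe, Closeds.coe_iInf, Set.mem_iInter]

lemma mem_cartierStableLocus {L : CartierDivisor X} {x : X} :
    x ∈ cartierStableLocus L ↔ ∀ m : ℕ+, x ∈ baseLocus ((m : ℕ) • L) := by
  simp only [cartierStableLocus, ← SetLike.mem_coe, Closeds.coe_iInf, Set.mem_iInter]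

/-- Only one inclusion comes this way: `|g^*L|` may have members that are not pulled back from `Z`.
-/
lemma map_mem_baseLocus_of_mem_baseLocus_pullbackDivisor (g : X ⟶ Z) [IsDominant g]
    {L : CartierDivisor Z} {x : X} (hx : x ∈ baseLocus (pullbackDivisor g L)) :
    g x ∈ baseLocus L :=
  mem_baseLocus.mpr fun _ hE => map_mem_support_of_mem_support_pullbackDivisor g
    (mem_baseLocus.mp hx _ (pullbackDivisor_mem_linearSystem g hE))

lemma map_mem_cartierStableLocus_of_mem_cartierStableLocus_pullbackDivisor (g : X ⟶ Z)
    [IsDominant g] {L : CartierDivisor Z} {x : X}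
    (hx : x ∈ cartierStableLocus (pullbackDivisor g L)) : g x ∈ cartierStableLocus L :=
  mem_cartierStableLocus.mpr fun m => map_mem_baseLocus_of_mem_baseLocus_pullbackDivisor g
    (by rw [map_nsmul]; exact mem_cartierStableLocus.mp hx m)

/-! ### Factorizations of Frobenius -/

/-- Going around through `X` fixes the points of `Z` and raises local equations to the `p`-th power.
-/
lemma pullbackDivisor_pullbackDivisor_eq_nsmul {p : ℕ} [Fact p.Prime]
    {hp : (p : Γ(X, ⊤)) = 0} {g : X ⟶ Z} {h : Z ⟶ X} [IsDominant g] [Surjective g]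
    [IsDominant h] (hgh : g ≫ h = absoluteFrobenius p X hp) (L : CartierDivisor Z) :
    pullbackDivisor h (pullbackDivisor g L) = p • L := by
  refine Subtype.ext (funext fun z => ?_)
  have hz : g (h z) = z := by
    obtain ⟨x, rfl⟩ := g.surjective z
    rw [base_comp_of_comp_eq_absoluteFrobenius hgh]
  obtain ⟨U, hzU, f, hf⟩ := L.2 z
  -- One local equation `f` on `U` serves at both `g (h z)` and `z`, which avoids identifying the
  -- stalks at these two points.
  have hU : g (h z) ∈ U := by rwa [hz]
  change cartierStalkMap h z (cartierStalkMap g (h z) (L.1 (g (h z)))) = p • L.1 z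
  rw [hf _ hU, hf z hzU, cartierStalkMap_localClass, cartierStalkMap_localClass]
  change _ = localClass z (f ^ p)
  congr 1
  exact Units.ext (functionFieldMap_functionFieldMap_eq_pow' hgh f)

lemma cartierStableLocus_pullbackDivisor {p : ℕ} [Fact p.Prime]
    {hp : (p : Γ(X, ⊤)) = 0} {g : X ⟶ Z} {h : Z ⟶ X} [IsDominant g] [Surjective g]
    (hgh : g ≫ h = absoluteFrobenius p X hp) (L : CartierDivisor Z) :
    cartierStableLocus (pullbackDivisor g L) = (cartierStableLocus L).preimage g.continuous := by
  -- This makes `h` dominant, as pulling divisors back along it requires.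
  have : Surjective h := ⟨fun x => ⟨g x, base_comp_of_comp_eq_absoluteFrobenius hgh x⟩⟩
  ext x
  refine ⟨map_mem_cartierStableLocus_of_mem_cartierStableLocus_pullbackDivisor g, fun hx => ?_⟩
  have hx : g x ∈ cartierStableLocus L := hx
  -- Stability under multiples replaces `L` by `pL = h^*g^*L`, to which the easy inclusion for `h`
  -- applies.
  rw [← cartierStableLocus_nsmul L ⟨p, (Fact.out : p.Prime).pos⟩, PNat.mk_coe,
    ← pullbackDivisor_pullbackDivisor_eq_nsmul hgh] at hx
  have := map_mem_cartierStableLocus_of_mem_cartierStableLocus_pullbackDivisor h hx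
  rwa [base_comp_of_comp_eq_absoluteFrobenius hgh] at this

/-! ### ℚ-divisors and reduced subschemes -/

lemma pullbackQDivisor_toQDivisor (g : X ⟶ Z) [IsDominant g] (L : CartierDivisor Z) :
    pullbackQDivisor g (toQDivisor L) = toQDivisor (pullbackDivisor g L) := rfl

lemma stableLocus_pullbackQDivisor {p : ℕ} [Fact p.Prime]
    {hp : (p : Γ(X, ⊤)) = 0} {g : X ⟶ Z} {h : Z ⟶ X} [IsDominant g] [Surjective g]
    (hgh : g ≫ h = absoluteFrobenius p X hp) (D : QDivisor Z) :
    stableLocus (pullbackQDivisor g D) = (stableLocus D).preimage g.continuous := by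
  obtain ⟨b, L, hL⟩ := exists_cartier_multiple D
  have hL' : (b : ℕ) • pullbackQDivisor g D = toQDivisor (pullbackDivisor g L) := by
    rw [← map_nsmul, hL, pullbackQDivisor_toQDivisor]
  rw [stableLocus_eq hL, stableLocus_eq hL', cartierStableLocus_pullbackDivisor hgh]

/-- A radical is the vanishing ideal of the support, and the support of an inverse image ideal is
the preimage of the support. -/
lemma reducedPreimage_vanishingIdeal {X Z : Scheme.{u}} (g : X ⟶ Z) (S : Closeds Z) :
    reducedPreimage g (Scheme.IdealSheafData.vanishingIdeal S) =
      Scheme.IdealSheafData.vanishingIdeal (S.preimage g.continuous) := by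
  rw [reducedPreimage, ← Scheme.IdealSheafData.vanishingIdeal_support,
    Scheme.IdealSheafData.support_comap]
  rfl

end StableBase

theorem lemma4p4 {k : Type u} [Field k] [PerfectField k] (p : ℕ) [Fact p.Prime] [CharP k p]
    {X Z : Scheme.{u}} (sX : X ⟶ Spec (.of k)) (sZ : Z ⟶ Spec (.of k))
    [IsIntegral X] [IsSeparated sX] [LocallyOfFiniteType sX] [QuasiCompact sX]
    [IsIntegral Z] [IsSeparated sZ] [LocallyOfFiniteType sZ] [QuasiCompact sZ]
    (hX : StableBase.IsNormalScheme X) (hZ : StableBase.IsNormalScheme Z)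
    (g : X ⟶ Z) [IsFinite g] [Surjective g]
    (hg : StableBase.IsPurelyInseparableOfHeightOne p
      (StableBase.natCast_eq_zero_of_field p sX) g)
    (D : StableBase.QDivisor Z) :
    StableBase.stableBaseLocus (StableBase.pullbackQDivisor g D) =
      StableBase.reducedPreimage g (StableBase.stableBaseLocus D) := by
  obtain ⟨h, hgh⟩ := hg.exists_factor
  rw [StableBase.stableBaseLocus, StableBase.stableBaseLocus,
    StableBase.reducedPreimage_vanishingIdeal, StableBase.stableLocus_pullbackQDivisor hgh]
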